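/- A Gelfand--Tsetlin triangle of size $n$ is an array $X=(X_{i,j})_{n\ge i\ge j\ge 1}$ of positive integers with $X_{i+1,j}\le X_{i,j}\le X_{i+1,j+1}$ for $n-1\ge i\ge j\ge 1$. It is a Gog triangle if $X_{i,j}<X_{i,j+1}$ for $1\le j<i\le n-1$ and $X_{n,j}=j$ for $1\le j\le n$; it is a Magog triangle if $X_{j,j}\le j$ for $1\le j\le n$; and it is a GOGAm triangle if its image under the Schützenberger involution is a Magog triangle. Here the Schützenberger involution is $S=\omega_1\omega_2\cdots\omega_{n-1}$ with $\omega_j=s_js_{j-1}\cdots s_1$ (compositions of maps), where $s_k$ replaces, for $1\le j\le k$, the entry $X_{k,j}$ by $\max(X_{k+1,j},X_{k-1,j-1})+\min(X_{k+1,j+1},X_{k-1,j})-X_{k,j}$ (undefined entries being left out) and leaves the other rows unchanged. For $1\le k\le n$, an $(n,k)$ left Gog (resp. GOGAm) trapezoid is an array $(X_{i,j})_{n\ge i\ge j\ge 1,\ j\le k}$ formed by the entries with $j\le k$ of a Gog (resp. GOGAm) triangle of size $n$; an $(n,k)$ left Gelfand--Tsetlin trapezoid is such an array of positive integers satisfying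 those inequalities above that involve only its entries. An inversion on the leftmost diagonal of $X$ is an index $i$, $1\le i\le n-1$, with $X_{i,1}=X_{i+1,1}$. **Algorithm A.** Let $X$ be an $(n,2)$ left Gog trapezoid with leftmost-diagonal inversions $i_1>\dots>i_k$. Put $Y^{(0)}=X$. Given $Y^{(l)}$ with $0\le l<k$, let $m\le n$ be the largest integer with $Y^{(l)}_{m,2}=Y^{(l)}_{i_{l+1}+1,2}$; put $Y^{(l+1)}_{i,1}=Y^{(l)}_{i+1,1}$ for $i_{l+1}<i\le m-1$, $Y^{(l+1)}_{i,2}=Y^{(l)}_{i,2}-1$ for $i_{l+1}+1\le i\le m$, and leave all other entries unchanged. The output is $Y=Y^{(k)}$. **Algorithm B.** Let $Y$ be an $(n,2)$ left GOGAm trapezoid with leftmost-diagonal inversions $\iota_1>\dots>\iota_k$. Put $Y^{(k)}=Y$. Given $Y^{(l)}$ with $k\ge l\ge1$, let $p\ge 2$ be the smallest integer with $Y^{(l)}_{p,2}=Y^{(l)}_{\iota_l+1,2}$; put $Y^{(l-1)}_{i,1}=Y^{(l)}_{i-1,1}$ for $p\le i\le\iota_l$, $Y^{(l-1)}_{i,2}=Y^{(l)}_{i,2}+1$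 for $p\le i\le\iota_l+1$, and leave all other entries unchanged. The output is $Y^{(0)}$. **Theorem.** 1. For $n\ge1$, the set of $(n,1)$ left Gog trapezoids and the set of $(n,1)$ left GOGAm trapezoids both coincide with the set of sequences of positive integers $X_{n,1}\le X_{n-1,1}\le\dots\le X_{1,1}$ with $X_{j,1}\le n-j+1$ for all $j$; so the identity is a bijection between them. 2. For $n\ge2$, Algorithm A is a bijection from the $(n,2)$ left Gog trapezoids onto the $(n,2)$ left GOGAm trapezoids, and Algorithm B is a bijection in the opposite direction and is its inverse. If $Y$ is the image of $X$ under Algorithm A, then $X$ and $Y$ have the same number of inversions on the leftmost diagonal, $Y_{1,1}=X_{1,1}$, every intermediate array $Y^{(l)}$ is a left Gelfand--Tsetlin trapezoid, and Algorithm B applied to $Y$ runs through the same sequence $Y^{(l)}$ backwards. 3. Consequently, for $k\in\{1,2\}$ and all $n\ge k$, there are finitely many $(n,k)$ left Gog trapezoids and equally many $(n,k)$ left GOGAm trapezoids. -/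

import Mathlib

namespace GogTrapezoid

/-- Arrays of integers.  The entry in row `i` and column `j` is `X i j`; row `n` is the top row.
Triangular and trapezoidal arrays are the arrays vanishing outside of their index set, so that two
of them are equal exactly when they have the same entries. -/
abbrev Entries := ℕ → ℕ → ℤ

/-- The index set of left `(n, k)` trapezoids: the positions `(i, j)` with `n ≥ i ≥ j ≥ 1` and
`k ≥ j`.  For `k = n` it is the index set of triangles of size `n`. -/
def InTrapezoid (n k i j : ℕ) : Prop := 1 ≤ j ∧ j ≤ i ∧ i ≤ n ∧ j ≤ k

/-- Left Gelfand-Tsetlin trapezoids of shape `(n, k)`. -/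
structure IsGTTrapezoid (n k : ℕ) (X : Entries) : Prop where
  pos : ∀ i j, InTrapezoid n k i j → 0 < X i j
  eq_zero : ∀ i j, ¬ InTrapezoid n k i j → X i j = 0
  le_left : ∀ i j, 1 ≤ j → j ≤ i → i + 1 ≤ n → j ≤ k → X (i + 1) j ≤ X i j
  le_right : ∀ i j, 1 ≤ j → j ≤ i → i + 1 ≤ n → j + 1 ≤ k → X i j ≤ X (i + 1) (j + 1)

/-- Gelfand-Tsetlin triangles of size `n`. -/
def IsGTTriangle (n : ℕ) (X : Entries) : Prop := IsGTTrapezoid n n X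

/-- Gog triangles of size `n`: Gelfand-Tsetlin triangles with strictly increasing rows and with
top row `1, 2, …, n`. -/
structure IsGogTriangle (n : ℕ) (X : Entries) : Prop where
  gt : IsGTTriangle n X
  row_lt : ∀ i j, 1 ≤ j → j < i → i + 1 ≤ n → X i j < X i (j + 1)
  top_row : ∀ j, 1 ≤ j → j ≤ n → X n j = j

/-- Magog triangles of size `n`: Gelfand-Tsetlin triangles with `X j j ≤ j`. -/
structure IsMagogTriangle (n : ℕ) (X : Entries) : Prop where
  gt : IsGTTriangle n X
  diag_le : ∀ j, 1 ≤ j → j ≤ n → X j j ≤ j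

/-- The involution `s_k` (for `1 ≤ k ≤ n - 1`) on Gelfand-Tsetlin triangles: every entry of row `k`
is reflected in the smallest interval delimited by its neighbours.  Neighbours outside of the
triangle are left out of the maximum and the minimum. -/
def toggle (k : ℕ) (X : Entries) : Entries := fun i j =>
  if i = k ∧ 1 ≤ j ∧ j ≤ k then
    (if j = 1 then X (k + 1) j else max (X (k + 1) j) (X (k - 1) (j - 1))) +
      (if j = k then X (k + 1) (j + 1) else min (X (k + 1) (j + 1)) (X (k - 1) j)) - X k j
  else X i j

/-- `ω_j = s_j s_{j-1} ⋯ s_2 s_1`, as a composition of maps (`s_1` acts first). -/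
def omegaMap : ℕ → Entries → Entries
  | 0, X => X
  | j + 1, X => toggle (j + 1) (omegaMap j X)

/-- The composition `ω_1 ω_2 ⋯ ω_m` (`ω_m` acts first). -/
def omegaProd : ℕ → Entries → Entries
  | 0, X => X
  | m + 1, X => omegaProd m (omegaMap (m + 1) X)

/-- The Schützenberger involution `S = ω_1 ω_2 ⋯ ω_{n-1}` on Gelfand-Tsetlin triangles of
size `n`. -/
def schutzenberger (n : ℕ) (X : Entries) : Entries := omegaProd (n - 1) X

/-- GOGAm triangles of size `n`: Gelfand-Tsetlin triangles whose image by the Schützenberger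
involution is a Magog triangle. -/
def IsGOGAmTriangle (n : ℕ) (X : Entries) : Prop :=
  IsGTTriangle n X ∧ IsMagogTriangle n (schutzenberger n X)

/-- The `k` leftmost NW-SE diagonals of a triangle, that is, its columns `1, …, k`. -/
def leftPart (k : ℕ) (X : Entries) : Entries := fun i j => if j ≤ k then X i j else 0

/-- The set of `(n, k)` left Gog trapezoids. -/
def leftGog (n k : ℕ) : Set Entries := leftPart k '' {X | IsGogTriangle n X}

/-- The set of `(n, k)` left GOGAm trapezoids. -/
def leftGOGAm (n k : ℕ) : Set Entries := leftPart k '' {X | IsGOGAmTriangle n X}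

/-- The inversions of the leftmost NW-SE diagonal, from NW to SE: the indices
`n > i_1 > i_2 > ⋯ ≥ 1` with `X i 1 = X (i + 1) 1`, in decreasing order. -/
def inversions (n : ℕ) (X : Entries) : List ℕ :=
  (List.range n).reverse.filter fun i => 1 ≤ i ∧ X i 1 = X (i + 1) 1

/-- One step of the algorithm from Gog to GOGAm, at the inversion `i`.  Here `m` is the largest
row with `Y m 2 = Y (i + 1) 2`; the entries `Y r 1` with `i < r ≤ m - 1` are replaced by
`Y (r + 1) 1`, and the entries `Y r 2` with `i + 1 ≤ r ≤ m` are decreased by `1`. -/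
def gogStep (n : ℕ) (Y : Entries) (i : ℕ) : Entries :=
  let m := Nat.findGreatest (fun m => Y m 2 = Y (i + 1) 2) n
  fun r c =>
    if c = 1 ∧ i < r ∧ r < m then Y (r + 1) 1
    else if c = 2 ∧ i + 1 ≤ r ∧ r ≤ m then Y r 2 - 1
    else Y r c

/-- One step of the inverse algorithm, at the inversion `i`.  Here `p` is the smallest row
(of the second diagonal, so `p ≥ 2`) with `Y p 2 = Y (i + 1) 2`; the entries `Y r 1` with
`p ≤ r ≤ i` are replaced by `Y (r - 1) 1`, and the entries `Y r 2` with `p ≤ r ≤ i + 1` are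
increased by `1`. -/
noncomputable def gogamStep (i : ℕ) (Y : Entries) : Entries :=
  let p := sInf {p : ℕ | 2 ≤ p ∧ Y p 2 = Y (i + 1) 2}
  fun r c =>
    if c = 1 ∧ p ≤ r ∧ r ≤ i then Y (r - 1) 1
    else if c = 2 ∧ p ≤ r ∧ r ≤ i + 1 then Y r 2 + 1
    else Y r c

/-- The array `Y^(l)` obtained from `X = Y^(0)` by treating the first `l` of the inversions
`i_1 > i_2 > ⋯ > i_k` of `X`, in the order `i_1, …, i_l`. -/
def gogStage (n : ℕ) (X : Entries) (l : ℕ) : Entries :=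
  ((inversions n X).take l).foldl (gogStep n) X

/-- The algorithm from Gog to GOGAm, `X ↦ Y^(k)`, where `k` is the number of inversions of the
leftmost diagonal of `X`. -/
def gogToGOGAm (n : ℕ) (X : Entries) : Entries := gogStage n X (inversions n X).length

/-- The array `Y^(l)` obtained from `Y = Y^(k)` by treating the inversions `ι_k, …, ι_{l+1}`, in
this order, where `ι_1 > ι_2 > ⋯ > ι_k` are the inversions of the leftmost diagonal of `Y`. -/
noncomputable def gogamStage (n : ℕ) (Y : Entries) (l : ℕ) : Entries :=
  ((inversions n Y).drop l).foldr gogamStep Y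

/-- The inverse algorithm from GOGAm to Gog, `Y ↦ Y^(0)`. -/
noncomputable def gogamToGog (n : ℕ) (Y : Entries) : Entries := gogamStage n Y 0

end GogTrapezoid

open GogTrapezoid

/-! Both kinds of two-column trapezoids have a local description. In a Gog triangle the remaining
columns only impose `X i 2 ≤ n + 2 - i`, besides `X n 1 = 1` and `X i 1 < X i 2` (`leftGog_two`).
For a GOGAm triangle, the rightmost entries of the Schützenberger image are bounded below by `X n
1`, by the second-column entries and by the sums `X (i + 1) 1 + X (i + 1) 2 - X i 1`. The Magog
bounds thus force `X n 1 = 1`, `X i 2 ≤ n + 2 - i`, and `X (i + 1) 2 ≤ n - i` at each inversion `i`.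
These conditions suffice, since the completion with constant diagonals has a Magog image
(`omegaProd_diag_le`, `leftGOGAm_two`).

Gog thus asks for strict rows, GOGAm for one unit less at inversions, and `IsMixed n t` asks for the
former up to row `t` and the latter from `t` on. A step of Algorithm A at the largest inversion `i <
t` changes the level `t` into `i` and moves that inversion to the end of a run of equal
second-column entries (`lower_isMixed`). The condition `sep` keeps runs from crossing the level, so
the inverse step recognises the same run (`raise_isMixed`). Induction on the list of inversions
gives the bijection and the reversed sequence of stages.

With one column, the local descriptions project to the same set: the second column is chosen as
large as possible for Gog, as small as possible for GOGAm. -/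

namespace GogTrapezoid

/-! ### Toggles and their compositions on Gelfand-Tsetlin triangles -/

section Toggle

variable {n k : ℕ} {X : Entries}

theorem toggle_apply_of_ne {i : ℕ} (h : i ≠ k) (j : ℕ) : toggle k X i j = X i j := by
  simp [toggle, h]

/-- A toggled entry stays in the interval delimited by its neighbours. -/
theorem toggle_mem (hX : IsGTTriangle n X) (hkn : k + 1 ≤ n) {j : ℕ} (hj : 1 ≤ j) (hjk : j ≤ k) :
    X (k + 1) j ≤ toggle k X k j ∧ toggle k X k j ≤ X (k + 1) (j + 1) ∧
      (2 ≤ j → X (k - 1) (j - 1) ≤ toggle k X k j) ∧ (j < k → toggle k X k j ≤ X (k - 1) j) := by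
  have h1 := hX.le_left k j hj hjk hkn (by omega)
  have h2 := hX.le_right k j hj hjk hkn (by omega)
  have h3 : 2 ≤ j → X (k - 1) (j - 1) ≤ X k j := fun h => by
    have := hX.le_right (k - 1) (j - 1) (by omega) (by omega) (by omega) (by omega)
    rwa [Nat.sub_add_cancel (by omega), Nat.sub_add_cancel (by omega)] at this
  have h4 : j < k → X k j ≤ X (k - 1) j := fun h => by
    have := hX.le_left (k - 1) j (by omega) (by omega) (by omega) (by omega)
    rwa [Nat.sub_add_cancel (by omega)] at this
  have h5 : 2 ≤ j → j < k → X (k - 1) (j - 1) ≤ X (k - 1) j := fun h h' =>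
    (h3 h).trans (h4 h')
  simp only [toggle, hj, hjk, and_self, if_true]
  split_ifs with ha hb hb <;> (try subst ha) <;> (try subst hb) <;> omega

theorem toggle_isGTTriangle (hX : IsGTTriangle n X) (hkn : k + 1 ≤ n) :
    IsGTTriangle n (toggle k X) where
  pos i j h := by
    obtain ⟨h1, h2, h3, h4⟩ := h
    by_cases hik : i = k
    · subst hik
      exact (hX.pos (i + 1) j ⟨h1, by omega, hkn, h4⟩).trans_le (toggle_mem hX hkn h1 h2).1
    · rw [toggle_apply_of_ne hik]
      exact hX.pos i j ⟨h1, h2, h3, h4⟩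
  eq_zero i j h := by
    rw [toggle, if_neg]
    · exact hX.eq_zero i j h
    · rintro ⟨rfl, h1, h2⟩
      exact h ⟨h1, h2, by omega, by omega⟩
  le_left i j h1 h2 h3 h4 := by
    by_cases hik : i = k
    · subst hik
      rw [toggle_apply_of_ne (show i + 1 ≠ i by omega)]
      exact (toggle_mem hX hkn h1 h2).1
    · rw [toggle_apply_of_ne hik]
      by_cases hik' : i + 1 = k
      · subst hik'
        exact (toggle_mem hX hkn h1 (by omega)).2.2.2 (by omega)
      · rw [toggle_apply_of_ne hik']
        exact hX.le_left i j h1 h2 h3 h4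
  le_right i j h1 h2 h3 h4 := by
    by_cases hik : i = k
    · subst hik
      rw [toggle_apply_of_ne (show i + 1 ≠ i by omega)]
      exact (toggle_mem hX hkn h1 h2).2.1
    · rw [toggle_apply_of_ne hik]
      by_cases hik' : i + 1 = k
      · subst hik'
        exact (toggle_mem hX hkn (by omega) (by omega)).2.2.1 (by omega)
      · rw [toggle_apply_of_ne hik']
        exact hX.le_right i j h1 h2 h3 h4

theorem omegaMap_isGTTriangle (hX : IsGTTriangle n X) :
    ∀ m, m + 1 ≤ n → IsGTTriangle n (omegaMap m X)
  | 0, _ => hX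
  | m + 1, h => toggle_isGTTriangle (omegaMap_isGTTriangle hX m (by omega)) h

theorem omegaProd_isGTTriangle :
    ∀ (m : ℕ) {X : Entries}, IsGTTriangle n X → m + 1 ≤ n → IsGTTriangle n (omegaProd m X)
  | 0, _, hX, _ => hX
  | m + 1, _, hX, h =>
    omegaProd_isGTTriangle m (omegaMap_isGTTriangle hX (m + 1) h) (by omega)

theorem omegaMap_apply_of_lt (X : Entries) {i : ℕ} (j : ℕ) :
    ∀ m, m < i → omegaMap m X i j = X i j
  | 0, _ => rfl
  | m + 1, h => by
    rw [omegaMap, toggle_apply_of_ne (by omega), omegaMap_apply_of_lt X j m (by omega)]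

theorem omegaMap_apply_of_le (X : Entries) {i m : ℕ} (j : ℕ) (h : i ≤ m) :
    omegaMap m X i j = omegaMap i X i j := by
  induction m, h using Nat.le_induction with
  | base => rfl
  | succ m h ih => rw [omegaMap, toggle_apply_of_ne (by omega), ih]

theorem omegaProd_apply_of_lt {i : ℕ} (j : ℕ) :
    ∀ (m : ℕ) (X : Entries), m < i → omegaProd m X i j = X i j
  | 0, _, _ => rfl
  | m + 1, X, h => by
    rw [omegaProd, omegaProd_apply_of_lt j m _ (by omega), omegaMap_apply_of_lt X j _ h]

/-- The recursion for the rows of `omegaMap m X`. -/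
theorem omegaMap_succ_apply (X : Entries) {k j : ℕ} (hj : 1 ≤ j) (hjk : j ≤ k + 1) :
    omegaMap (k + 1) X (k + 1) j =
      (if j = 1 then X (k + 2) j else max (X (k + 2) j) (omegaMap k X k (j - 1))) +
      (if j = k + 1 then X (k + 2) (j + 1) else min (X (k + 2) (j + 1)) (omegaMap k X k j)) -
        X (k + 1) j := by
  simp only [omegaMap, toggle, hj, hjk, and_self, if_true, Nat.add_sub_cancel]
  rw [omegaMap_apply_of_lt X _ k (by omega : k < k + 1 + 1),
    omegaMap_apply_of_lt X _ k (by omega : k < k + 1 + 1),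
    omegaMap_apply_of_lt X _ k (by omega : k < k + 1)]

/-- `ω_k` preserves interlacing and does not touch row `k + 1`, so its new row `k` still interlaces
with the old row `k + 1`. -/
theorem le_omegaMap (hX : IsGTTriangle n X) {k j : ℕ} (hj : 1 ≤ j) (hjk : j ≤ k) (hk : k + 1 ≤ n) :
    X (k + 1) j ≤ omegaMap k X k j := by
  have := (omegaMap_isGTTriangle hX k hk).le_left k j hj hjk hk (by omega)
  rwa [omegaMap_apply_of_lt X _ k (by omega : k < k + 1)] at this

theorem IsGTTrapezoid.diag_mono {l : ℕ} (hX : IsGTTrapezoid n l X) {i j : ℕ} (hj : 1 ≤ j)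
    (hji : j ≤ i) (d : ℕ) (h : i + d ≤ n) (h' : j + d ≤ l) : X i j ≤ X (i + d) (j + d) := by
  induction d with
  | zero => rfl
  | succ d ih =>
    exact (ih (by omega) (by omega)).trans
      (hX.le_right (i + d) (j + d) (by omega) (by omega) (by omega) (by omega))

end Toggle

/-! ### Bounds for the rightmost entries of the Schützenberger image -/

section Schutzenberger

variable {n : ℕ}

theorem omegaMap_one_one (X : Entries) : omegaMap 1 X 1 1 = X 2 1 + X 2 2 - X 1 1 := by
  simp [omegaMap, toggle]

/-- The behaviour under `ω_m` of the sum of the first two entries of a row minus the first entry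
of the previous row. -/
theorem omegaMap_two_sub (X : Entries) {k : ℕ} (hk : 1 ≤ k) :
    omegaMap (k + 1) X (k + 1) 1 + omegaMap (k + 1) X (k + 1) 2 - omegaMap k X k 1 =
      X (k + 2) 1 + X (k + 2) 2 - X (k + 1) 1 +
      ((if k = 1 then X (k + 2) 3 else min (X (k + 2) 3) (omegaMap k X k 2)) - X (k + 1) 2) := by
  rw [omegaMap_succ_apply X le_rfl (by omega), omegaMap_succ_apply X (by omega) (by omega)]
  have h1 : ¬ (1 = k + 1) := by omega
  have h2 : (2 = k + 1) ↔ k = 1 := by omega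
  simp only [h1, h2, if_true, if_false, Nat.reduceAdd, Nat.reduceSub,
    OfNat.ofNat_ne_one]
  split_ifs <;> omega

/-- By `le_omegaMap`, each `ω` carries the bound one row down. When it reaches row `2`, row `k` is
no longer modified, and the diagonal from `(2, 2)` to `(k, k)` is increasing. -/
theorem le_omegaProd_of_second (m : ℕ) {X : Entries} (hX : IsGTTriangle n X) (hm : m + 1 ≤ n)
    {k : ℕ} (hk : 2 ≤ k) (hkm : k ≤ m + 1) : X (m + 3 - k) 2 ≤ omegaProd m X k k := by
  induction m generalizing X with
  | zero => omega
  | succ m ih =>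
    rcases Nat.lt_or_ge (m + 1) k with h | h
    · obtain rfl : k = m + 2 := by omega
      rw [omegaProd_apply_of_lt _ _ _ (by omega)]
      have := hX.diag_mono (i := 2) (j := 2) (by omega) le_rfl m (by omega) (by omega)
      rw [show m + 1 + 3 - (m + 2) = 2 by omega, add_comm m 2]
      exact this
    · refine le_trans ?_ (ih (omegaMap_isGTTriangle hX (m + 1) hm) (by omega) h)
      rw [omegaMap_apply_of_le X _ (by omega), show m + 1 + 3 - k = m + 3 - k + 1 by omega]
      exact le_omegaMap hX (by omega) (by omega) (by omega)

theorem le_omegaProd_of_first (m : ℕ) {X : Entries} (hX : IsGTTriangle n X) (hm : m + 1 ≤ n) :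
    X (m + 1) 1 ≤ omegaProd m X 1 1 := by
  induction m generalizing X with
  | zero => rfl
  | succ m ih =>
    refine le_trans ?_ (ih (omegaMap_isGTTriangle hX (m + 1) hm) (by omega))
    exact le_omegaMap hX le_rfl (by omega) (by omega)

/-- The combination moves down one row under each `ω` without decreasing, by `omegaMap_two_sub`. On
the two lowest rows it is exactly the toggled entry `(1, 1)`, and the diagonal from there increases.
-/
theorem le_omegaProd_of_two_sub (m : ℕ) {X : Entries} (hX : IsGTTriangle n X) (hm : m + 1 ≤ n)
    {k : ℕ} (hk : 1 ≤ k) (hkm : k ≤ m) :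
    X (m + 2 - k) 1 + X (m + 2 - k) 2 - X (m + 1 - k) 1 ≤ omegaProd m X k k := by
  induction m generalizing X with
  | zero => omega
  | succ m ih =>
    have hX' := omegaMap_isGTTriangle hX (m + 1) hm
    rcases Nat.lt_or_ge m k with h | h
    · obtain rfl : k = m + 1 := by omega
      rw [omegaProd, omegaProd_apply_of_lt _ _ _ (by omega), show m + 1 + 2 - (m + 1) = 2 by omega,
        show m + 1 + 1 - (m + 1) = 1 by omega, ← omegaMap_one_one,
        ← omegaMap_apply_of_le X 1 (show 1 ≤ m + 1 by omega)]
      have := hX'.diag_mono (i := 1) (j := 1) le_rfl le_rfl m (by omega) (by omega)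
      rwa [add_comm 1 m] at this
    · refine le_trans ?_ (ih hX' (by omega) h)
      obtain ⟨b, rfl⟩ : ∃ b, m = k + b := ⟨m - k, by omega⟩
      rw [show k + b + 1 + 2 - k = b + 1 + 2 by omega, show k + b + 1 + 1 - k = b + 1 + 1 by omega,
        show k + b + 1 - k = b + 1 by omega,
        omegaMap_apply_of_le X 1 (show b + 1 + 1 ≤ k + b + 1 by omega),
        omegaMap_apply_of_le X 2 (show b + 1 + 1 ≤ k + b + 1 by omega),
        omegaMap_apply_of_le X 1 (show b + 1 ≤ k + b + 1 by omega), omegaMap_two_sub X (by omega)]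
      -- Both arguments of the minimum are at least `X (b + 2) 2`, so the correction term is
      -- nonnegative.
      have h1 := hX.le_right (b + 2) 2 (by omega) (by omega) (by omega) (by omega)
      have h2 : b + 1 ≠ 1 → X (b + 2) 2 ≤ omegaMap (b + 1) X (b + 1) 2 := fun _ =>
        le_omegaMap hX (by omega) (by omega) (by omega)
      change X (b + 2) 2 ≤ X (b + 3) 3 at h1
      change X (b + 3) 1 + X (b + 3) 2 - X (b + 2) 1 ≤ X (b + 3) 1 + X (b + 3) 2 - X (b + 2) 1 +
        ((if b + 1 = 1 then X (b + 3) 3 else min (X (b + 3) 3) (omegaMap (b + 1) X (b + 1) 2)) -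
          X (b + 2) 2)
      split_ifs with hb
      · omega
      · have := h2 hb
        omega

/-- If the diagonals of the first `m + 1` rows are constant from the second column on, the bounds
on the first two columns bound the rightmost entries after `ω_1 ⋯ ω_m`. -/
theorem omegaProd_diag_le (m : ℕ) {X : Entries} (hX : IsGTTriangle n X) (hm : m + 1 ≤ n)
    (hc : ∀ i j, 2 ≤ j → j ≤ i → i ≤ m → X (i + 1) (j + 1) = X i j)
    (hx : X (m + 1) 1 ≤ 1)
    (hy : ∀ b, 1 ≤ b → b ≤ m → X (b + 1) 2 ≤ (m : ℤ) + 2 - b)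
    (hf : ∀ b, 1 ≤ b → b ≤ m → X (b + 1) 1 + X (b + 1) 2 - X b 1 ≤ (m : ℤ) + 1 - b)
    {k : ℕ} (hk : 1 ≤ k) (hkm : k ≤ m + 1) : omegaProd m X k k ≤ k := by
  induction m generalizing X with
  | zero =>
    obtain rfl : k = 1 := by omega
    exact_mod_cast hx
  | succ m ih =>
    rcases Nat.lt_or_ge (m + 1) k with h | h
    -- This row is never modified, and its last entry equals `X 2 2` by constancy of the diagonal.
    · obtain rfl : k = m + 2 := by omega
      rw [omegaProd_apply_of_lt _ _ _ (by omega)]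
      have key : ∀ d, d ≤ m → X (d + 2) (d + 2) = X 2 2 := fun d hd => by
        induction d with
        | zero => rfl
        | succ d ih' => rw [← ih' (by omega)]; exact hc (d + 2) (d + 2) (by omega) le_rfl (by omega)
      rw [key m le_rfl]
      have := hy 1 le_rfl (by omega)
      push_cast at this ⊢
      norm_num at this
      omega
    · have le1 : ∀ k, 1 ≤ k → k ≤ m → X (k + 2) 3 = X (k + 1) 2 := fun k h h' =>
        hc (k + 1) 2 le_rfl (by omega) (by omega)
      -- Constancy of the diagonals makes the minimum in the reflection equal to the reflected
      -- entry; the two cancel and only the maximum survives.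
      have row : ∀ k j, 2 ≤ j → j ≤ k + 1 → k ≤ m → omegaMap (k + 1) X (k + 1) j =
          max (X (k + 2) j) (omegaMap k X k (j - 1)) := fun k j h1 h2 h3 => by
        rw [omegaMap_succ_apply X (by omega) h2, if_neg (by omega), hc (k + 1) j h1 h2 (by omega)]
        have : j ≠ k + 1 → X (k + 1) j ≤ omegaMap k X k j := fun h =>
          le_omegaMap hX (by omega) (by omega) (by omega)
        split_ifs with hb
        · omega
        · have := this hb
          omega
      have hfst : ∀ k, 1 ≤ k → k ≤ m + 1 →
          omegaMap k X k 1 ≤ X (k + 1) 1 + X (k + 1) 2 - X k 1 := fun k h1 h2 => by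
        obtain ⟨k, rfl⟩ : ∃ k', k = k' + 1 := ⟨k - 1, by omega⟩
        rw [omegaMap_succ_apply X le_rfl (by omega), if_pos rfl]
        simp only [Nat.reduceAdd]
        change _ ≤ X (k + 2) 1 + X (k + 2) 2 - X (k + 1) 1
        split_ifs <;> omega
      -- All four hypotheses reproduce themselves after `ω_{m+1}`, with `m + 1` replaced by `m`. The
      -- bound on the first entry comes from `hf` at `b = m + 1`.
      refine ih (X := omegaMap (m + 1) X) (omegaMap_isGTTriangle hX (m + 1) hm) (by omega)
        ?_ ?_ ?_ ?_ h
      · intro i j h1 h2 h3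
        rw [omegaMap_apply_of_le X (j + 1) (show i + 1 ≤ m + 1 by omega),
          omegaMap_apply_of_le X j (show i ≤ m + 1 by omega),
          row i (j + 1) (by omega) (by omega) h3, Nat.add_sub_cancel]
        refine max_eq_right ?_
        rw [hc (i + 1) j h1 (by omega) (by omega)]
        exact le_omegaMap hX (by omega) h2 (by omega)
      · have := hfst (m + 1) (by omega) le_rfl
        have h3 := hf (m + 1) (by omega) le_rfl
        push_cast at h3
        omega
      -- The new second entry is a maximum whose two terms are controlled by `hy` at `b + 1` and by
      -- `hf` at `b`.
      · intro b h1 h2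
        rw [omegaMap_apply_of_le X _ (by omega), row b 2 le_rfl (by omega) h2]
        have h3 := hy (b + 1) (by omega) (by omega)
        have h4 := hfst b h1 (by omega)
        have h5 := hf b h1 (by omega)
        push_cast at h3 h5
        change X (b + 2) 2 ≤ _ at h3
        simp only [Nat.reduceSub]
        omega
      -- The correction term of `omegaMap_two_sub` now vanishes, so this is `hf` at `b + 1`.
      · intro b h1 h2
        rw [omegaMap_apply_of_le X 1 (show b + 1 ≤ m + 1 by omega),
          omegaMap_apply_of_le X 2 (show b + 1 ≤ m + 1 by omega),
          omegaMap_apply_of_le X 1 (show b ≤ m + 1 by omega),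
          omegaMap_two_sub X h1, le1 b h1 h2]
        have h3 := hf (b + 1) (by omega) (by omega)
        push_cast at h3
        change X (b + 2) 1 + X (b + 2) 2 - X (b + 1) 1 ≤ _ at h3
        have h6 : b ≠ 1 → X (b + 1) 2 ≤ omegaMap b X b 2 := fun h =>
          le_omegaMap hX (by omega) (by omega) (by omega)
        split_ifs with hb
        · omega
        · have := h6 hb
          omega

end Schutzenberger

/-! ### Local descriptions of the two-diagonal trapezoids -/

section LeftParts

variable {n t : ℕ} {X Y : Entries}

/-- The arrays interpolating between the left Gog trapezoids (`t = n`) and the left GOGAm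
trapezoids (`t = 1`) with two diagonals: the Gog condition is imposed up to row `t`, the GOGAm
condition above row `t`. -/
structure IsMixed (n t : ℕ) (Y : Entries) : Prop where
  gt : IsGTTrapezoid n 2 Y
  bot : Y n 1 = 1
  le : ∀ i, 2 ≤ i → i ≤ n → Y i 2 ≤ (n : ℤ) + 2 - i
  lt : ∀ i, 2 ≤ i → i ≤ t → Y i 1 < Y i 2
  inv : ∀ i, 1 ≤ i → t ≤ i → i + 1 ≤ n → Y i 1 = Y (i + 1) 1 → Y (i + 1) 2 ≤ (n : ℤ) - i
  sep : 2 ≤ t → t + 1 ≤ n → Y (t + 1) 2 < Y t 2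

theorem leftPart_apply {k j : ℕ} (h : j ≤ k) (X : Entries) (i : ℕ) : leftPart k X i j = X i j :=
  if_pos h

theorem leftPart_isGTTrapezoid (hX : IsGTTriangle n X) (l : ℕ) :
    IsGTTrapezoid n l (leftPart l X) where
  pos i j h := by
    obtain ⟨h1, h2, h3, h4⟩ := h
    rw [leftPart_apply h4]
    exact hX.pos i j ⟨h1, h2, h3, by omega⟩
  eq_zero i j h := by
    rw [leftPart]
    split_ifs with h'
    · exact hX.eq_zero i j fun ⟨h1, h2, h3, _⟩ => h ⟨h1, h2, h3, h'⟩
    · rfl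
  le_left i j h1 h2 h3 h4 := by
    rw [leftPart_apply h4, leftPart_apply h4]
    exact hX.le_left i j h1 h2 h3 (by omega)
  le_right i j h1 h2 h3 h4 := by
    rw [leftPart_apply h4, leftPart_apply (by omega)]
    exact hX.le_right i j h1 h2 h3 (by omega)

theorem leftPart_one_leftPart_two (X : Entries) : leftPart 1 (leftPart 2 X) = leftPart 1 X := by
  funext i j
  simp only [leftPart]
  split_ifs <;> first | rfl | (exfalso; omega)

theorem image_leftPart_one (S : Set Entries) : leftPart 1 '' S = leftPart 1 '' (leftPart 2 '' S) := by
  rw [Set.image_image]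
  simp only [leftPart_one_leftPart_two]

/-- The completion of a trapezoid `Y` with two diagonals to a triangle whose entries on the other
diagonals are those of `Z`. -/
def complete (n : ℕ) (Y Z : Entries) : Entries := fun i j =>
  if 1 ≤ j ∧ j ≤ i ∧ i ≤ n then (if j ≤ 2 then Y i j else Z i j) else 0

theorem leftPart_complete (hY : IsGTTrapezoid n 2 Y) (Z : Entries) :
    leftPart 2 (complete n Y Z) = Y := by
  funext i j
  by_cases h : InTrapezoid n 2 i j
  · obtain ⟨h1, h2, h3, h4⟩ := h
    simp [leftPart, complete, h1, h2, h3, h4]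
  · rw [hY.eq_zero i j h]
    simp only [InTrapezoid] at h
    simp only [leftPart, complete]
    split_ifs <;> first | rfl | (exfalso; omega)

theorem complete_apply {Z : Entries} {i j : ℕ} (h1 : 1 ≤ j) (h2 : j ≤ i) (h3 : i ≤ n) :
    complete n Y Z i j = if j ≤ 2 then Y i j else Z i j :=
  if_pos ⟨h1, h2, h3⟩

theorem complete_isGTTriangle (hY : IsGTTrapezoid n 2 Y) {Z : Entries}
    (hpos : ∀ i j, 3 ≤ j → j ≤ i → i ≤ n → 0 < Z i j)
    (hl : ∀ i j, 3 ≤ j → j ≤ i → i + 1 ≤ n → Z (i + 1) j ≤ Z i j)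
    (hr : ∀ i j, 3 ≤ j → j ≤ i → i + 1 ≤ n → Z i j ≤ Z (i + 1) (j + 1))
    (hYZ : ∀ i, 2 ≤ i → i + 1 ≤ n → Y i 2 ≤ Z (i + 1) 3) :
    IsGTTriangle n (complete n Y Z) where
  pos i j h := by
    obtain ⟨h1, h2, h3, h4⟩ := h
    rw [complete_apply h1 h2 h3]
    split_ifs with h
    · exact hY.pos i j ⟨h1, h2, h3, h⟩
    · exact hpos i j (by omega) h2 h3
  eq_zero i j h := if_neg fun ⟨h1, h2, h3⟩ => h ⟨h1, h2, h3, by omega⟩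
  le_left i j h1 h2 h3 h4 := by
    rw [complete_apply h1 h2 (by omega), complete_apply h1 (by omega) h3]
    split_ifs with h
    · exact hY.le_left i j h1 h2 h3 h
    · exact hl i j (by omega) h2 h3
  le_right i j h1 h2 h3 h4 := by
    rw [complete_apply h1 h2 (by omega), complete_apply (by omega) (by omega) h3]
    rcases Nat.lt_trichotomy j 2 with h | rfl | h
    · rw [if_pos (by omega), if_pos (by omega)]
      exact hY.le_right i j h1 h2 h3 (by omega)
    · rw [if_pos le_rfl, if_neg (by omega)]
      exact hYZ i h2 h3
    · rw [if_neg (by omega), if_neg (by omega)]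
      exact hr i j (by omega) h2 h3

/-- The bound on the second column propagates along diagonals from the prescribed top row.
Conversely, the other columns are filled with the largest values this top row allows, `n - i + j`.
-/
theorem leftGog_two (hn : 1 ≤ n) : leftGog n 2 = {Y | IsMixed n n Y} := by
  ext Y
  constructor
  · rintro ⟨X, hX, rfl⟩
    simp only [Set.mem_ofPred_eq] at hX ⊢
    have e1 : ∀ i, leftPart 2 X i 1 = X i 1 := leftPart_apply (by omega) X
    have e2 : ∀ i, leftPart 2 X i 2 = X i 2 := leftPart_apply le_rfl X
    refine ⟨leftPart_isGTTrapezoid hX.gt 2, ?_, ?_, ?_, fun i _ _ _ => by omega,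
      fun _ _ => by omega⟩
    · rw [e1]
      exact_mod_cast hX.top_row 1 le_rfl hn
    · intro i h1 h2
      have h3 := hX.gt.diag_mono (i := i) (j := 2) (by omega) h1 (n - i) (by omega) (by omega)
      rw [show i + (n - i) = n by omega, hX.top_row _ (by omega) (by omega)] at h3
      rw [e2]
      push_cast [h2] at h3
      omega
    · intro i h1 h2
      rw [e1, e2]
      rcases h2.lt_or_eq with h2 | rfl
      · exact hX.row_lt i 1 le_rfl (by omega) h2
      · rw [hX.top_row 1 le_rfl hn, hX.top_row 2 (by omega) h1]
        norm_num
  · intro hY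
    simp only [Set.mem_ofPred_eq] at hY
    refine ⟨complete n Y fun i j => (n : ℤ) - i + j, ?_, leftPart_complete hY.gt _⟩
    constructor
    · refine complete_isGTTriangle hY.gt ?_ ?_ ?_ ?_
      · intro i j h1 h2 h3
        omega
      · intro i j h1 h2 h3
        push_cast
        omega
      · intro i j h1 h2 h3
        push_cast
        omega
      · intro i h1 h2
        have := hY.le i h1 (by omega)
        push_cast
        omega
    · intro i j h1 h2 h3
      rw [complete_apply h1 (by omega) (by omega), complete_apply (by omega) (by omega) (by omega)]
      rcases Nat.lt_trichotomy j 2 with h | rfl | h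
      · obtain rfl : j = 1 := by omega
        simpa using hY.lt i (by omega) (by omega)
      · have := hY.le i (by omega) (by omega)
        simp only [le_refl, if_true, Nat.reduceAdd, Nat.reduceLeDiff, if_false]
        push_cast
        omega
      · rw [if_neg (by omega), if_neg (by omega)]
        push_cast
        omega
    · intro j h1 h2
      rw [complete_apply h1 h2 le_rfl]
      split_ifs with h
      · rcases (show j = 1 ∨ j = 2 by omega) with rfl | rfl
        · exact_mod_cast hY.bot
        · have h3 := hY.lt n h2 le_rfl
          have h4 := hY.le n h2 le_rfl
          have h5 := hY.bot
          push_cast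
          omega
      · omega

/-- Necessity comes from the three lower bounds on the image. For sufficiency the triangle is
completed with the smallest possible entries, constant along diagonals from the second column on. -/
theorem leftGOGAm_two (hn : 1 ≤ n) : leftGOGAm n 2 = {Y | IsMixed n 1 Y} := by
  obtain ⟨m, rfl⟩ : ∃ m, n = m + 1 := ⟨n - 1, by omega⟩
  ext Y
  constructor
  · rintro ⟨X, ⟨hX, hS⟩, rfl⟩
    simp only [Set.mem_ofPred_eq]
    have hd : ∀ k, 1 ≤ k → k ≤ m + 1 → omegaProd m X k k ≤ k := hS.diag_le
    have e1 : ∀ i, leftPart 2 X i 1 = X i 1 := leftPart_apply (by omega) X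
    have e2 : ∀ i, leftPart 2 X i 2 = X i 2 := leftPart_apply le_rfl X
    refine ⟨leftPart_isGTTrapezoid hX 2, ?_, ?_, fun i _ _ => by omega, ?_,
      fun _ => by omega⟩
    · have h1 := le_omegaProd_of_first m hX le_rfl
      have h2 := hd 1 le_rfl (by omega)
      have h3 := hX.pos (m + 1) 1 ⟨le_rfl, by omega, le_rfl, by omega⟩
      rw [e1]
      push_cast at h2
      omega
    · intro i h1 h2
      have h3 := le_omegaProd_of_second m hX le_rfl (k := m + 3 - i) (by omega) (by omega)
      have h4 := hd (m + 3 - i) (by omega) (by omega)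
      rw [show m + 3 - (m + 3 - i) = i by omega] at h3
      rw [e2]
      push_cast [show i ≤ m + 3 by omega] at h4 ⊢
      omega
    · intro i h1 _ h2
      -- At an inversion the two first-column entries cancel, leaving the bound on `X (i + 1) 2`.
      have h3 := le_omegaProd_of_two_sub m hX le_rfl (k := m + 1 - i) (by omega) (by omega)
      have h4 := hd (m + 1 - i) (by omega) (by omega)
      rw [show m + 2 - (m + 1 - i) = i + 1 by omega, show m + 1 - (m + 1 - i) = i by omega] at h3
      rw [e1, e1, e2]
      intro h5
      push_cast [show i ≤ m + 1 by omega] at h4 ⊢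
      omega
  · intro hY
    simp only [Set.mem_ofPred_eq] at hY
    have hX : IsGTTriangle (m + 1) (complete (m + 1) Y fun i j => Y (i - j + 2) 2) := by
      refine complete_isGTTriangle hY.gt ?_ ?_ ?_ ?_
      · intro i j h1 h2 h3
        exact hY.gt.pos _ 2 ⟨by omega, by omega, by omega, le_rfl⟩
      · intro i j h1 h2 h3
        rw [show i + 1 - j + 2 = i - j + 2 + 1 by omega]
        exact hY.gt.le_left _ 2 (by omega) (by omega) (by omega) le_rfl
      · intro i j h1 h2 h3
        rw [show i + 1 - (j + 1) + 2 = i - j + 2 by omega]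
      · intro i h1 h2
        rw [show i + 1 - 3 + 2 = i by omega]
    refine ⟨_, ⟨hX, omegaProd_isGTTriangle m hX le_rfl, ?_⟩, leftPart_complete hY.gt _⟩
    intro k h1 h2
    refine omegaProd_diag_le m hX le_rfl ?_ ?_ ?_ ?_ h1 h2
    · intro i j h1 h2 h3
      rw [complete_apply (by omega) (by omega) (by omega),
        complete_apply (by omega) (by omega) (by omega), if_neg (by omega),
        show i + 1 - (j + 1) + 2 = i - j + 2 by omega]
      split_ifs with h
      · obtain rfl : j = 2 := by omega
        rw [show i - 2 + 2 = i by omega]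
      · rfl
    · rw [complete_apply (by omega) (by omega) (by omega)]
      exact hY.bot.le
    · intro b h1 h2
      rw [complete_apply (by omega) (by omega) (by omega)]
      have := hY.le (b + 1) (by omega) (by omega)
      push_cast at this
      simp only [le_refl, if_true]
      omega
    · intro b h1 h2
      rw [complete_apply (by omega) (by omega) (by omega),
        complete_apply (by omega) (by omega) (by omega),
        complete_apply (by omega) (by omega) (by omega)]
      -- At an inversion `inv` gives the bound; otherwise the first column drops by at least `1`,
      -- which makes `le` sufficient.
      have h3 := hY.le (b + 1) (by omega) (by omega)
      have h4 := hY.inv b h1 h1 (by omega)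
      have h5 := hY.gt.le_left b 1 le_rfl h1 (by omega) (by omega)
      push_cast at h3 h4
      simp only [le_refl, if_true, Nat.one_le_ofNat]
      omega

/-! ### One-diagonal trapezoids and finiteness -/

theorem IsMixed.first_le (hY : IsMixed n t Y) {i : ℕ} (h1 : 1 ≤ i) (h2 : i ≤ n) :
    Y i 1 ≤ (n : ℤ) - i + 1 := by
  rcases h2.lt_or_eq with h2 | rfl
  · have h3 := hY.gt.le_right i 1 le_rfl h1 h2 le_rfl
    have h4 := hY.le (i + 1) (by omega) h2
    push_cast at h4
    change _ ≤ Y (i + 1) 2 at h3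
    omega
  · have := hY.bot
    omega

/-- The trapezoids with one diagonal that come from Gog or GOGAm triangles. -/
def oneDiagonal (n : ℕ) : Set Entries :=
  {X | IsGTTrapezoid n 1 X ∧ ∀ j : ℕ, 1 ≤ j → j ≤ n → X j 1 ≤ (n : ℤ) - j + 1}

theorem IsMixed.leftPart_one_mem (hY : IsMixed n t Y) : leftPart 1 Y ∈ oneDiagonal n := by
  refine ⟨⟨?_, ?_, ?_, fun i j h1 h2 h3 h4 => by omega⟩, ?_⟩
  · rintro i j ⟨h1, h2, h3, h4⟩
    rw [leftPart_apply h4]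
    exact hY.gt.pos i j ⟨h1, h2, h3, by omega⟩
  · intro i j h
    rw [leftPart]
    split_ifs with h'
    · exact hY.gt.eq_zero i j fun ⟨h1, h2, h3, _⟩ => h ⟨h1, h2, h3, h'⟩
    · rfl
  · intro i j h1 h2 h3 h4
    rw [leftPart_apply h4, leftPart_apply h4]
    exact hY.gt.le_left i j h1 h2 h3 (by omega)
  · intro j h1 h2
    rw [leftPart_apply le_rfl]
    exact hY.first_le h1 h2

/-- The trapezoid with two diagonals whose diagonals are that of `X` and `g`. -/
def addDiagonal (n : ℕ) (X : Entries) (g : ℕ → ℤ) : Entries := fun i j =>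
  if j = 2 ∧ 2 ≤ i ∧ i ≤ n then g i else X i j

theorem addDiagonal_one (g : ℕ → ℤ) (i : ℕ) : addDiagonal n X g i 1 = X i 1 :=
  if_neg (by omega)

theorem addDiagonal_two (g : ℕ → ℤ) {i : ℕ} (h : 2 ≤ i) (h' : i ≤ n) :
    addDiagonal n X g i 2 = g i :=
  if_pos ⟨rfl, h, h'⟩

theorem leftPart_addDiagonal (hX : IsGTTrapezoid n 1 X) (g : ℕ → ℤ) :
    leftPart 1 (addDiagonal n X g) = X := by
  funext i j
  simp only [leftPart, addDiagonal]
  split_ifs with h1 h2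
  · omega
  · rfl
  · exact (hX.eq_zero i j fun h => h1 h.2.2.2).symm

theorem addDiagonal_isGTTrapezoid (hX : IsGTTrapezoid n 1 X) {g : ℕ → ℤ}
    (hg : ∀ i, 2 ≤ i → i + 1 ≤ n → g (i + 1) ≤ g i)
    (hXg : ∀ i, 1 ≤ i → i + 1 ≤ n → X i 1 ≤ g (i + 1)) :
    IsGTTrapezoid n 2 (addDiagonal n X g) where
  pos i j h := by
    obtain ⟨h1, h2, h3, h4⟩ := h
    rcases (show j = 1 ∨ j = 2 by omega) with rfl | rfl
    · rw [addDiagonal_one]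
      exact hX.pos i 1 ⟨h1, h2, h3, h1⟩
    · rw [addDiagonal_two _ h2 h3]
      obtain ⟨i, rfl⟩ : ∃ i', i = i' + 1 := ⟨i - 1, by omega⟩
      exact (hX.pos i 1 ⟨le_rfl, by omega, by omega, le_rfl⟩).trans_le (hXg i (by omega) h3)
  eq_zero i j h := by
    rw [addDiagonal, if_neg]
    · exact hX.eq_zero i j fun ⟨h1, h2, h3, h4⟩ => h ⟨h1, h2, h3, by omega⟩
    · rintro ⟨rfl, h2, h3⟩
      exact h ⟨by omega, h2, h3, le_rfl⟩
  le_left i j h1 h2 h3 h4 := by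
    rcases (show j = 1 ∨ j = 2 by omega) with rfl | rfl
    · rw [addDiagonal_one, addDiagonal_one]
      exact hX.le_left i 1 h1 h2 h3 h1
    · rw [addDiagonal_two _ h2 (by omega), addDiagonal_two _ (by omega) h3]
      exact hg i h2 h3
  le_right i j h1 h2 h3 h4 := by
    obtain rfl : j = 1 := by omega
    rw [addDiagonal_one, addDiagonal_two _ (by omega) h3]
    exact hXg i h2 h3

theorem leftGog_one (hn : 1 ≤ n) : leftGog n 1 = oneDiagonal n := by
  rw [leftGog, image_leftPart_one]
  change leftPart 1 '' leftGog n 2 = _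
  rw [leftGog_two hn]
  refine Set.Subset.antisymm ?_ ?_
  · rintro _ ⟨Y, hY, rfl⟩
    exact hY.leftPart_one_mem
  · rintro X ⟨hX, hle⟩
    have hp := hX.pos n 1 ⟨le_rfl, hn, le_rfl, le_rfl⟩
    have hb := hle n hn le_rfl
    -- The largest admissible second column makes the rows strict.
    refine ⟨addDiagonal n X fun i => (n : ℤ) + 2 - i, ⟨addDiagonal_isGTTrapezoid hX ?_ ?_, ?_, ?_,
      ?_, fun i _ _ _ => by omega, fun _ _ => by omega⟩, leftPart_addDiagonal hX _⟩
    · intro i h1 h2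
      push_cast
      omega
    · intro i h1 h2
      have := hle i h1 (by omega)
      push_cast
      omega
    · rw [addDiagonal_one]
      omega
    · intro i h1 h2
      rw [addDiagonal_two _ h1 h2]
    · intro i h1 h2
      rw [addDiagonal_one, addDiagonal_two _ h1 h2]
      have := hle i (by omega) h2
      omega

theorem leftGOGAm_one (hn : 1 ≤ n) : leftGOGAm n 1 = oneDiagonal n := by
  rw [leftGOGAm, image_leftPart_one]
  change leftPart 1 '' leftGOGAm n 2 = _
  rw [leftGOGAm_two hn]
  refine Set.Subset.antisymm ?_ ?_
  · rintro _ ⟨Y, hY, rfl⟩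
    exact hY.leftPart_one_mem
  · rintro X ⟨hX, hle⟩
    have hp := hX.pos n 1 ⟨le_rfl, hn, le_rfl, le_rfl⟩
    have hb := hle n hn le_rfl
    -- The smallest admissible second column: at an inversion `i` its entry in row `i + 1` is `X i 1
    -- = X (i + 1) 1 ≤ n - i`.
    refine ⟨addDiagonal n X fun i => X (i - 1) 1, ⟨addDiagonal_isGTTrapezoid hX ?_ ?_, ?_, ?_,
      fun i _ _ => by omega, ?_, fun _ => by omega⟩, leftPart_addDiagonal hX _⟩
    · intro i h1 h2
      have := hX.le_left (i - 1) 1 le_rfl (by omega) (by omega) le_rfl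
      rwa [Nat.sub_add_cancel (by omega)] at this
    · intro i h1 h2
      rfl
    · rw [addDiagonal_one]
      omega
    · intro i h1 h2
      rw [addDiagonal_two _ h1 h2]
      have := hle (i - 1) (by omega) (by omega)
      omega
    · intro i h1 _ h2
      rw [addDiagonal_one, addDiagonal_one, addDiagonal_two _ (by omega) h2, Nat.add_sub_cancel]
      intro h3
      have := hle (i + 1) (by omega) h2
      push_cast at this
      omega

theorem finite_setOf_isMixed (n t : ℕ) : {Y | IsMixed n t Y}.Finite := by
  have hfin : (Set.univ.pi fun _ : Fin (n + 1) × Fin 3 => Set.Icc (0 : ℤ) n).Finite :=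
    Set.Finite.pi fun _ => Set.finite_Icc _ _
  refine Set.Finite.of_finite_image
    (f := fun (Y : Entries) (p : Fin (n + 1) × Fin 3) => Y p.1 p.2) (hfin.subset ?_) ?_
  · rintro _ ⟨Y, hY, rfl⟩ ⟨i, j⟩ _
    change Y i j ∈ _
    by_cases h : InTrapezoid n 2 i j
    · refine ⟨(hY.gt.pos i j h).le, ?_⟩
      obtain ⟨h1, h2, h3, h4⟩ := h
      rcases (show (j : ℕ) = 1 ∨ (j : ℕ) = 2 by omega) with h | h
      · rw [h]
        have := hY.first_le (by omega) h3
        omega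
      · rw [h]
        have := hY.le i (by omega) h3
        omega
    · rw [hY.gt.eq_zero i j h]
      simp
  · intro Y hY Z hZ h
    funext i j
    by_cases hij : InTrapezoid n 2 i j
    · obtain ⟨h1, h2, h3, h4⟩ := hij
      exact congrFun h (⟨i, by omega⟩, ⟨j, by omega⟩)
    · rw [hY.gt.eq_zero i j hij, hZ.gt.eq_zero i j hij]

end LeftParts

/-! ### One step of each algorithm -/

section Algorithm

variable {n t i m : ℕ} {Y : Entries}

/-- The entries of the first diagonal are moved down by one row in the rows `i < r < m`, and those
of the second diagonal are decreased by `1` in the rows `i < r ≤ m`. -/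
def lower (i m : ℕ) (Y : Entries) : Entries := fun r c =>
  if c = 1 ∧ i < r ∧ r < m then Y (r + 1) 1
  else if c = 2 ∧ i < r ∧ r ≤ m then Y r 2 - 1
  else Y r c

/-- The operation inverse to `lower`. -/
def raise (i m : ℕ) (Y : Entries) : Entries := fun r c =>
  if c = 1 ∧ i < r ∧ r < m then Y (r - 1) 1
  else if c = 2 ∧ i < r ∧ r ≤ m then Y r 2 + 1
  else Y r c

theorem lower_one (Y : Entries) (i m r : ℕ) :
    lower i m Y r 1 = if i < r ∧ r < m then Y (r + 1) 1 else Y r 1 := by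
  simp [lower]

theorem lower_two (Y : Entries) (i m r : ℕ) :
    lower i m Y r 2 = if i < r ∧ r ≤ m then Y r 2 - 1 else Y r 2 := by
  simp [lower]

theorem raise_one (Y : Entries) (i m r : ℕ) :
    raise i m Y r 1 = if i < r ∧ r < m then Y (r - 1) 1 else Y r 1 := by
  simp [raise]

theorem raise_two (Y : Entries) (i m r : ℕ) :
    raise i m Y r 2 = if i < r ∧ r ≤ m then Y r 2 + 1 else Y r 2 := by
  simp [raise]

/-- The only entry the shift can lose is `Y (i + 1) 1`, and the inversion keeps a copy of it in row
`i`. In `lower_raise` the copy of `Y (m - 1) 1` is in row `m`. -/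
theorem raise_lower (h : Y i 1 = Y (i + 1) 1) : raise i m (lower i m Y) = Y := by
  funext r c
  by_cases h1 : c = 1
  · subst h1
    rw [raise_one, lower_one, lower_one]
    split_ifs with h2 h3
    · rw [Nat.sub_add_cancel (by omega)]
    · obtain rfl : r = i + 1 := by omega
      exact h
    · rfl
  · by_cases h2 : c = 2
    · subst h2
      rw [raise_two, lower_two]
      split_ifs <;> omega
    · simp [raise, lower, h1, h2]

theorem lower_raise (h : Y (m - 1) 1 = Y m 1) : lower i m (raise i m Y) = Y := by
  funext r c
  by_cases h1 : c = 1
  · subst h1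
    rw [lower_one, raise_one, raise_one]
    split_ifs with h2 h3
    · rw [Nat.add_sub_cancel]
    · obtain rfl : m = r + 1 := by omega
      exact h.symm
    · rfl
  · by_cases h2 : c = 2
    · subst h2
      rw [lower_two, raise_two]
      split_ifs <;> omega
    · simp [raise, lower, h1, h2]

theorem gogStep_eq_lower (hmn : m ≤ n) (h : Y m 2 = Y (i + 1) 2)
    (h' : ∀ r, m < r → r ≤ n → Y r 2 ≠ Y (i + 1) 2) : gogStep n Y i = lower i m Y := by
  have : Nat.findGreatest (fun m => Y m 2 = Y (i + 1) 2) n = m :=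
    Nat.findGreatest_eq_iff.2 ⟨hmn, fun _ => h, fun {r} h1 h2 => h' r h1 h2⟩
  simp only [gogStep, this]
  rfl

/-- A run of second-column entries ending in row `m` belongs to the inversion `m - 1`; its first row
is `p = i + 1`. -/
theorem gogamStep_eq_raise (hi : 1 ≤ i) (him : i < m) (h : Y (i + 1) 2 = Y m 2)
    (h' : ∀ r, 2 ≤ r → r ≤ i → Y r 2 ≠ Y m 2) : gogamStep (m - 1) Y = raise i m Y := by
  have : sInf {p : ℕ | 2 ≤ p ∧ Y p 2 = Y (m - 1 + 1) 2} = i + 1 := by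
    rw [Nat.sub_add_cancel (by omega)]
    refine le_antisymm (Nat.sInf_le ⟨by omega, h⟩) (le_csInf ⟨i + 1, by omega, h⟩ ?_)
    rintro r ⟨h1, h2⟩
    by_contra h3
    exact h' r h1 (by omega) h2
  funext r c
  simp only [gogamStep, this, raise]
  have e1 : (i + 1 ≤ r ∧ r ≤ m - 1) ↔ (i < r ∧ r < m) := by omega
  have e2 : (i + 1 ≤ r ∧ r ≤ m - 1 + 1) ↔ (i < r ∧ r ≤ m) := by omega
  simp only [e1, e2]

theorem IsGTTrapezoid.second_anti (hY : IsGTTrapezoid n 2 Y) {r s : ℕ} (hr : 2 ≤ r) (hrs : r ≤ s)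
    (hs : s ≤ n) : Y s 2 ≤ Y r 2 := by
  induction s, hrs using Nat.le_induction with
  | base => rfl
  | succ s h ih => exact (hY.le_left s 2 (by omega) (by omega) hs le_rfl).trans (ih (by omega))

/-- The conditions on two columns defining trapezoids with two diagonals. -/
theorem isGTTrapezoid_two_of (h0 : ∀ i j, ¬ InTrapezoid n 2 i j → Y i j = 0)
    (hp : 0 < Y n 1) (hl1 : ∀ i, 1 ≤ i → i + 1 ≤ n → Y (i + 1) 1 ≤ Y i 1)
    (hl2 : ∀ i, 2 ≤ i → i + 1 ≤ n → Y (i + 1) 2 ≤ Y i 2)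
    (hr : ∀ i, 1 ≤ i → i + 1 ≤ n → Y i 1 ≤ Y (i + 1) 2) : IsGTTrapezoid n 2 Y where
  pos := by
    have key : ∀ d i, 1 ≤ i → i + d = n → 0 < Y i 1 := fun d => by
      induction d with
      | zero =>
        rintro i h1 rfl
        exact hp
      | succ d ih =>
        intro i h1 h2
        exact (ih (i + 1) (by omega) (by omega)).trans_le (hl1 i h1 (by omega))
    rintro i j ⟨h1, h2, h3, h4⟩
    rcases (show j = 1 ∨ j = 2 by omega) with rfl | rfl
    · exact key (n - i) i h2 (by omega)
    · obtain ⟨i, rfl⟩ : ∃ i', i = i' + 1 := ⟨i - 1, by omega⟩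
      exact (key (n - i) i (by omega) (by omega)).trans_le (hr i (by omega) h3)
  eq_zero := h0
  le_left i j h1 h2 h3 h4 := by
    rcases (show j = 1 ∨ j = 2 by omega) with rfl | rfl
    · exact hl1 i h2 h3
    · exact hl2 i h2 h3
  le_right i j h1 h2 h3 h4 := by
    obtain rfl : j = 1 := by omega
    exact hr i h2 h3

/-- Strictness of the rows up to `t` leaves room to subtract `1` on the run `i < r ≤ m`, and the
strict drop after row `m` keeps the column monotone. The subtracted unit turns `le` into `inv` on
the run; it also creates the strict drop `sep` between rows `i` and `i + 1`. -/
theorem lower_isMixed (hY : IsMixed n t Y) (ht : t ≤ n) (hi : 1 ≤ i) (him : i < m) (hmt : m ≤ t)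
    (h : Y i 1 = Y (i + 1) 1) (hc : ∀ r, i < r → r ≤ m → Y r 2 = Y (i + 1) 2)
    (hm : m + 1 ≤ n → Y (m + 1) 2 < Y (i + 1) 2)
    (hinv : ∀ r, i < r → r < t → Y r 1 ≠ Y (r + 1) 1) : IsMixed n i (lower i m Y) where
  gt := by
    refine isGTTrapezoid_two_of ?_ ?_ ?_ ?_ ?_
    · intro r c hrc
      simp only [InTrapezoid] at hrc
      rw [lower, if_neg (by omega), if_neg (by omega)]
      exact hY.gt.eq_zero r c hrc
    · rw [lower_one, if_neg (by omega), hY.bot]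
      exact one_pos
    · intro r h1 h2
      have h3 := hY.gt.le_left r 1 le_rfl h1 h2 (by omega)
      have h4 : r + 1 < m → Y (r + 2) 1 ≤ Y (r + 1) 1 := fun h5 =>
        hY.gt.le_left (r + 1) 1 le_rfl (by omega) (by omega) (by omega)
      rw [lower_one, lower_one]
      split_ifs with h5 h6 h6
      · exact h4 h5.2
      · exact (h4 h5.2).trans h3
      · obtain rfl : r + 1 = m := by omega
        rfl
      · exact h3
    · intro r h1 h2
      have h3 := hY.gt.le_left r 2 (by omega) h1 h2 (by omega)
      rw [lower_two, lower_two]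
      split_ifs with h5 h6 h6
      · omega
      · omega
      · obtain rfl : r = m := by omega
        have := hm h2
        have := hc r him le_rfl
        omega
      · exact h3
    · intro r h1 h2
      have h3 : Y r 1 ≤ Y (r + 1) 2 := hY.gt.le_right r 1 le_rfl h1 h2 le_rfl
      rw [lower_one, lower_two]
      split_ifs with h5 h6 h6
      · have := hY.lt (r + 1) (by omega) (by omega)
        omega
      · omega
      · obtain rfl : r = i := by omega
        have := hY.lt (r + 1) (by omega) (by omega)
        omega
      · exact h3
  bot := by
    rw [lower_one, if_neg (by omega), hY.bot]
  le r h1 h2 := by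
    have := hY.le r h1 h2
    rw [lower_two]
    split_ifs <;> omega
  lt r h1 h2 := by
    rw [lower_one, lower_two, if_neg (by omega), if_neg (by omega)]
    exact hY.lt r h1 (by omega)
  inv r h1 h2 h3 := by
    rw [lower_two]
    split_ifs with h4
    · intro _
      have := hY.le (r + 1) (by omega) h3
      push_cast at this
      omega
    · rw [lower_one, lower_one, if_neg (by omega), if_neg (by omega)]
      intro h5
      refine hY.inv r h1 ?_ h3 h5
      by_contra h6
      exact hinv r (by omega) (by omega) h5
  sep h1 h2 := by
    rw [lower_two, lower_two, if_pos (by omega), if_neg (by omega)]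
    have := hY.gt.le_left i 2 (by omega) h1 h2 le_rfl
    omega

/-- The inversion `m - 1` provides, through `inv`, the unit needed to add `1` on the run. Rows of
the run become strict by this addition. A row `r` with `t < r ≤ i` is already strict, since `r - 1`
is not an inversion and `Y r 1 < Y (r - 1) 1 ≤ Y r 2`. -/
theorem raise_isMixed (hY : IsMixed n t Y) (ht : 1 ≤ t) (hti : t ≤ i) (him : i < m) (hmn : m ≤ n)
    (h : Y (m - 1) 1 = Y m 1) (hc : ∀ r, i < r → r ≤ m → Y r 2 = Y m 2)
    (hi : 2 ≤ i → Y m 2 < Y i 2)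
    (hinv : ∀ r, t ≤ r → r + 1 < m → Y r 1 ≠ Y (r + 1) 1) : IsMixed n m (raise i m Y) := by
  have hm : Y m 2 ≤ (n : ℤ) + 1 - m := by
    have := hY.inv (m - 1) (by omega) (by omega) (by omega)
    rw [Nat.sub_add_cancel (by omega)] at this
    have := this h
    push_cast [show 1 ≤ m by omega] at this
    omega
  have hr : ∀ r, 1 ≤ r → r + 1 ≤ n → Y r 1 ≤ Y (r + 1) 2 := fun r h1 h2 =>
    hY.gt.le_right r 1 le_rfl h1 h2 le_rfl
  have hl : ∀ r, 1 ≤ r → r + 1 ≤ n → Y (r + 1) 1 ≤ Y r 1 := fun r h1 h2 =>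
    hY.gt.le_left r 1 le_rfl h1 h2 (by omega)
  refine ⟨isGTTrapezoid_two_of ?_ ?_ ?_ ?_ ?_, ?_, ?_, ?_, ?_, ?_⟩
  · intro r c hrc
    simp only [InTrapezoid] at hrc
    rw [raise, if_neg (by omega), if_neg (by omega)]
    exact hY.gt.eq_zero r c hrc
  · rw [raise_one, if_neg (by omega), hY.bot]
    exact one_pos
  · intro r h1 h2
    have h3 := hl r h1 h2
    have h4 : i < r → Y r 1 ≤ Y (r - 1) 1 := fun h5 => by
      have := hl (r - 1) (by omega) (by omega)
      rwa [Nat.sub_add_cancel (by omega)] at this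
    rw [raise_one, raise_one]
    split_ifs with h5 h6 h6
    · exact h4 h6.1
    · rfl
    · exact h3.trans (h4 h6.1)
    · exact h3
  · intro r h1 h2
    have h3 := hY.gt.le_left r 2 (by omega) h1 h2 (by omega)
    rw [raise_two, raise_two]
    split_ifs with h5 h6 h6
    · omega
    · obtain rfl : r = i := by omega
      have := hi h1
      have := hc (r + 1) h5.1 h5.2
      omega
    · omega
    · exact h3
  · intro r h1 h2
    have h3 := hr r h1 h2
    have h4 : i < r → Y r 1 ≤ Y (r - 1) 1 ∧ Y (r - 1) 1 ≤ Y r 2 := fun h5 => by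
      have h6 := hl (r - 1) (by omega) (by omega)
      have h7 := hr (r - 1) (by omega) (by omega)
      rw [Nat.sub_add_cancel (by omega)] at h6 h7
      exact ⟨h6, h7⟩
    rw [raise_one, raise_two]
    split_ifs with h5 h6 h6
    · have := h4 h5.1
      have := hc r h5.1 h5.2.le
      have := hc (r + 1) h6.1 h6.2
      omega
    · omega
    · omega
    · exact h3
  · rw [raise_one, if_neg (by omega), hY.bot]
  · intro r h1 h2
    have h3 := hY.le r h1 h2
    rw [raise_two]
    split_ifs with h4
    · rw [hc r h4.1 h4.2]
      omega
    · exact h3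
  · intro r h1 h2
    have h3 := hr (r - 1) (by omega) (by omega)
    have h4 := hl (r - 1) (by omega) (by omega)
    have h5 := hinv (r - 1)
    rw [Nat.sub_add_cancel (by omega)] at h3 h4 h5
    rw [raise_one, raise_two]
    split_ifs with h6 h7 h7
    · omega
    · omega
    · omega
    · rcases Nat.lt_or_ge t r with h8 | h8
      · have := h5 (by omega) (by omega)
        omega
      · exact hY.lt r h1 h8
  · intro r h1 h2 h3
    rw [raise_one, raise_one, raise_two, if_neg (by omega), if_neg (by omega), if_neg (by omega)]
    exact hY.inv r h1 (by omega) h3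
  · intro h1 h2
    rw [raise_two, raise_two, if_neg (by omega), if_pos (by omega)]
    have := hY.gt.le_left m 2 (by omega) h1 h2 le_rfl
    omega

end Algorithm

/-! ### How a step moves inversions, and runs of the second column -/

section Inversions

variable {n t i m : ℕ} {Y : Entries}

theorem mem_inversions {r : ℕ} :
    r ∈ inversions n Y ↔ 1 ≤ r ∧ r < n ∧ Y r 1 = Y (r + 1) 1 := by
  simp only [inversions, List.mem_filter, List.mem_reverse, List.mem_range, decide_eq_true_eq]
  tauto

theorem inversions_pairwise (n : ℕ) (Y : Entries) : (inversions n Y).Pairwise (· > ·) :=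
  (List.pairwise_reverse.2 List.pairwise_lt_range).filter _

theorem inversions_eq_of_mem_iff {l : List ℕ} (hl : l.Pairwise (· > ·))
    (h : ∀ r, r ∈ inversions n Y ↔ r ∈ l) : inversions n Y = l :=
  (inversions_pairwise n Y).eq_of_mem_iff hl h

/-- Replacing one inversion by another one without changing the order. -/
theorem inversions_replace {Y' : Entries} {J L : List ℕ} {a b : ℕ}
    (h : inversions n Y = J ++ a :: L) (hJ : ∀ j ∈ J, b < j) (hL : ∀ j ∈ L, j < b)
    (hb : 1 ≤ b) (hbn : b < n)
    (hY' : ∀ r, 1 ≤ r → r < n →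
      (Y' r 1 = Y' (r + 1) 1 ↔ r = b ∨ (r ≠ a ∧ Y r 1 = Y (r + 1) 1))) :
    inversions n Y' = J ++ b :: L := by
  have hp := inversions_pairwise n Y
  rw [h, List.pairwise_append, List.pairwise_cons] at hp
  obtain ⟨hpJ, ⟨haL, hpL⟩, hJa⟩ := hp
  refine inversions_eq_of_mem_iff ?_ fun r => ?_
  · rw [List.pairwise_append, List.pairwise_cons]
    refine ⟨hpJ, ⟨hL, hpL⟩, fun x hx y hy => ?_⟩
    rcases List.mem_cons.1 hy with rfl | hy
    · exact hJ x hx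
    · exact hJa x hx y (List.mem_cons_of_mem _ hy)
  · have hr : r ∈ inversions n Y ↔ r ∈ J ++ a :: L := by rw [h]
    have hJ' : r ∈ J → r ≠ a := fun hr => (hJa r hr a List.mem_cons_self).ne'
    have hL' : r ∈ L → r ≠ a := fun hr => (haL r hr).ne
    rw [mem_inversions] at hr ⊢
    simp only [List.mem_append, List.mem_cons] at hr ⊢
    have := hY' r
    by_cases hrb : r = b
    · subst hrb
      exact ⟨fun _ => Or.inr (Or.inl rfl), fun _ => ⟨hb, hbn, (this hb hbn).2 (Or.inl rfl)⟩⟩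
    · constructor
      · rintro ⟨h1, h2, h3⟩
        rcases (this h1 h2).1 h3 with h4 | ⟨h4, h5⟩
        · exact absurd h4 hrb
        · rcases hr.1 ⟨h1, h2, h5⟩ with h6 | h6 | h6
          · exact Or.inl h6
          · exact absurd h6 h4
          · exact Or.inr (Or.inr h6)
      · intro h1
        have hra : r ≠ a := by
          rcases h1 with h1 | h1 | h1
          · exact hJ' h1
          · exact absurd h1 hrb
          · exact hL' h1
        obtain ⟨h2, h3, h4⟩ := hr.2 (by tauto)
        exact ⟨h2, h3, (this h2 h3).2 (Or.inr ⟨hra, h4⟩)⟩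

/-- The shift duplicates `Y m 1` in row `m - 1`, creating an inversion there, and removes the
duplicate at `i`. The other differences in the window are merely shifted, and none is zero. -/
theorem lower_inversion_iff (him : i < m)
    (h : Y i 1 = Y (i + 1) 1) (hinv : ∀ r, i < r → r < m → Y r 1 ≠ Y (r + 1) 1) (r : ℕ) :
    lower i m Y r 1 = lower i m Y (r + 1) 1 ↔ r = m - 1 ∨ (r ≠ i ∧ Y r 1 = Y (r + 1) 1) := by
  rw [lower_one, lower_one]
  by_cases h1 : r < i
  · rw [if_neg (by omega), if_neg (by omega)]
    omega
  by_cases h2 : r = i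
  · subst h2
    rw [if_neg (by omega)]
    split_ifs with h3
    · have h4 := hinv (r + 1) (by omega) (by omega)
      have h5 : r ≠ m - 1 := by omega
      simp only [h, h4, h5, ne_eq, not_true, false_and, or_self]
    · obtain rfl : m = r + 1 := by omega
      simpa using h
  by_cases h3 : r < m
  · rw [if_pos (by omega)]
    split_ifs with h4
    · have h5 := hinv (r + 1) (by omega) (by omega)
      have h6 := hinv r (by omega) (by omega)
      have h7 : r ≠ m - 1 := by omega
      simp only [h5, h6, h7, and_false, or_self]
    · obtain rfl : m = r + 1 := by omega
      simp
  · rw [if_neg (by omega), if_neg (by omega)]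
    have : r ≠ m - 1 := by omega
    simp only [this, show r ≠ i by omega, ne_eq, not_false_eq_true, true_and, false_or]

theorem raise_inversion_iff (him : i < m)
    (h : Y (m - 1) 1 = Y m 1) (hinv : ∀ r, i ≤ r → r + 1 < m → Y r 1 ≠ Y (r + 1) 1) (r : ℕ) :
    raise i m Y r 1 = raise i m Y (r + 1) 1 ↔ r = i ∨ (r ≠ m - 1 ∧ Y r 1 = Y (r + 1) 1) := by
  rw [raise_one, raise_one, Nat.add_sub_cancel]
  by_cases h1 : r < i
  · rw [if_neg (by omega), if_neg (by omega)]
    omega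
  by_cases h2 : r = i
  · subst h2
    rw [if_neg (by omega)]
    split_ifs with h3
    · simp
    · obtain rfl : m = r + 1 := by omega
      simpa using h
  by_cases h3 : r < m
  · rw [if_pos (by omega)]
    have h5 := hinv (r - 1) (by omega) (by omega)
    rw [Nat.sub_add_cancel (by omega)] at h5
    split_ifs with h4
    · have := hinv r (by omega) (by omega)
      simp only [h2, this, h5, and_false, or_self]
    · obtain rfl : m = r + 1 := by omega
      rw [Nat.add_sub_cancel] at h ⊢
      rw [← h]
      simp only [h2, h5, ne_eq, not_true, false_and, or_self]
  · rw [if_neg (by omega), if_neg (by omega)]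
    have : r ≠ m - 1 := by omega
    simp only [h2, ne_eq, this, not_false_eq_true, true_and, false_or]

/-- The second column is monotone, so its level sets are intervals of rows; `sep` stops the run of
row `i + 1` at row `t`. -/
theorem exists_window_above (hY : IsMixed n t Y) (hi : 1 ≤ i) (hit : i < t) (ht : t ≤ n) :
    ∃ m, i < m ∧ m ≤ t ∧ (∀ r, i < r → r ≤ m → Y r 2 = Y (i + 1) 2) ∧
      ∀ r, m < r → r ≤ n → Y r 2 < Y (i + 1) 2 := by
  set m := Nat.findGreatest (fun m => Y m 2 = Y (i + 1) 2) n with hm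
  have h1 : i + 1 ≤ m := Nat.le_findGreatest (by omega) rfl
  have hmn : m ≤ n := Nat.findGreatest_le n
  have h2 : Y m 2 = Y (i + 1) 2 :=
    Nat.findGreatest_spec (P := fun m => Y m 2 = Y (i + 1) 2) (show i + 1 ≤ n by omega) rfl
  refine ⟨m, h1, ?_, fun r hr hr' => ?_, fun r hr hr' => ?_⟩
  · by_contra h3
    have h4 := hY.sep (by omega) (by omega)
    have h5 := hY.gt.second_anti (show 2 ≤ i + 1 by omega) (show i + 1 ≤ t by omega) ht
    have h6 := hY.gt.second_anti (show 2 ≤ t + 1 by omega) (show t + 1 ≤ m by omega) hmn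
    omega
  · have h5 := hY.gt.second_anti (show 2 ≤ i + 1 by omega) (show i + 1 ≤ r by omega) (by omega)
    have h6 := hY.gt.second_anti (show 2 ≤ r by omega) hr' hmn
    omega
  · have h5 := hY.gt.second_anti (show 2 ≤ i + 1 by omega) (show i + 1 ≤ r by omega) hr'
    exact lt_of_le_of_ne h5 (Nat.findGreatest_is_greatest hr hr')

theorem exists_window_below (hY : IsMixed n t Y) (ht : 1 ≤ t) (htm : t < m) (hmn : m ≤ n) :
    ∃ i, t ≤ i ∧ i < m ∧ (∀ r, i < r → r ≤ m → Y r 2 = Y m 2) ∧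
      ∀ r, 2 ≤ r → r ≤ i → Y m 2 < Y r 2 := by
  have hex : ∃ p, 2 ≤ p ∧ Y p 2 = Y m 2 := ⟨m, by omega, rfl⟩
  classical
  obtain ⟨h1, h2⟩ := Nat.find_spec hex
  have h3 : Nat.find hex ≤ m := Nat.find_min' hex ⟨by omega, rfl⟩
  have hmin : ∀ r, 2 ≤ r → r < Nat.find hex → Y r 2 ≠ Y m 2 := fun r hr hr' h =>
    Nat.find_min hex hr' ⟨hr, h⟩
  revert h1 h2 h3 hmin
  generalize Nat.find hex = p
  intro h1 h2 h3 hmin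
  refine ⟨p - 1, ?_, by omega, fun r hr hr' => ?_, fun r hr hr' => ?_⟩
  · by_contra h4
    have h5 := hY.sep (by omega) (by omega)
    have h6 := hY.gt.second_anti h1 (show p ≤ t by omega) (by omega)
    have h7 := hY.gt.second_anti (show 2 ≤ t + 1 by omega) htm hmn
    omega
  · have h5 := hY.gt.second_anti h1 (show p ≤ r by omega) (by omega)
    have h6 := hY.gt.second_anti (show 2 ≤ r by omega) hr' hmn
    omega
  · have h5 := hY.gt.second_anti hr (show r ≤ m by omega) hmn
    exact lt_of_le_of_ne h5 (hmin r hr (by omega)).symm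

end Inversions

/-! ### Iterating the steps -/

section Bijection

variable {n t : ℕ} {Y : Entries}

/-- One step of the algorithm, at the largest inversion `i` below `t`: it moves the inversion to
some `b ≥ i`, and is undone by the inverse step at `b`. -/
theorem exists_gogStep (hY : IsMixed n t Y) (ht : t ≤ n) {J L : List ℕ} {i : ℕ}
    (h : inversions n Y = J ++ i :: L) (hJ : ∀ j ∈ J, t ≤ j) (hit : i < t) :
    ∃ b, i ≤ b ∧ IsMixed n i (gogStep n Y i) ∧ inversions n (gogStep n Y i) = J ++ b :: L ∧
      gogamStep b (gogStep n Y i) = Y ∧ gogStep n Y i 1 1 = Y 1 1 := by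
  have hmem : i ∈ inversions n Y := by simp [h]
  obtain ⟨hi, hin, he⟩ := mem_inversions.1 hmem
  have hp := inversions_pairwise n Y
  rw [h, List.pairwise_append, List.pairwise_cons] at hp
  -- Treated inversions are at least `t` and pending ones are smaller than `i`.
  have hinv : ∀ r, i < r → r < t → Y r 1 ≠ Y (r + 1) 1 := fun r h1 h2 h3 => by
    have hr : r ∈ inversions n Y := mem_inversions.2 ⟨by omega, by omega, h3⟩
    rw [h, List.mem_append, List.mem_cons] at hr
    rcases hr with hr | hr | hr
    · have := hJ r hr
      omega
    · omega
    · have := hp.2.1.1 r hr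
      omega
  obtain ⟨m, him, hmt, hc, hm⟩ := exists_window_above hY hi hit ht
  have hstep : gogStep n Y i = lower i m Y :=
    gogStep_eq_lower (by omega) (hc m him le_rfl) fun r h1 h2 => (hm r h1 h2).ne
  rw [hstep]
  refine ⟨m - 1, by omega, lower_isMixed hY ht hi him hmt he hc (fun h => hm _ (by omega) h) hinv,
    inversions_replace h (fun j hj => ?_) (fun j hj => ?_) (by omega) (by omega) fun r _ _ =>
      lower_inversion_iff him he (fun r h1 h2 => hinv r h1 (by omega)) r, ?_,
    ?_⟩
  · have := hJ j hj
    omega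
  · have := hp.2.1.1 j hj
    omega
  · rw [gogamStep_eq_raise hi him, raise_lower he]
    · rw [lower_two, lower_two, if_pos (by omega), if_pos (by omega), hc m him le_rfl]
    · intro r h1 h2
      have := hY.gt.second_anti h1 (show r ≤ i + 1 by omega) (by omega)
      rw [lower_two, lower_two, if_neg (by omega), if_pos (by omega), hc m him le_rfl]
      omega
  · rw [lower_one, if_neg (by omega)]

/-- One step of the inverse algorithm, at the smallest inversion `b` not below `t`. -/
theorem exists_gogamStep (hY : IsMixed n t Y) (ht : 1 ≤ t) {J L : List ℕ} {b : ℕ}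
    (h : inversions n Y = J ++ b :: L) (hL : ∀ j ∈ L, j < t) (htb : t ≤ b) :
    ∃ i, i ≤ b ∧ IsMixed n (b + 1) (gogamStep b Y) ∧ inversions n (gogamStep b Y) = J ++ i :: L ∧
      gogStep n (gogamStep b Y) i = Y := by
  have hmem : b ∈ inversions n Y := by simp [h]
  obtain ⟨hb, hbn, he⟩ := mem_inversions.1 hmem
  have hp := inversions_pairwise n Y
  rw [h, List.pairwise_append, List.pairwise_cons] at hp
  have hinv : ∀ r, t ≤ r → r + 1 < b + 1 → Y r 1 ≠ Y (r + 1) 1 := fun r h1 h2 h3 => by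
    have hr : r ∈ inversions n Y := mem_inversions.2 ⟨by omega, by omega, h3⟩
    rw [h, List.mem_append, List.mem_cons] at hr
    rcases hr with hr | hr | hr
    · have := hp.2.2 r hr b List.mem_cons_self
      omega
    · omega
    · have := hL r hr
      omega
  obtain ⟨i, hti, him, hc, hi⟩ := exists_window_below hY ht (show t < b + 1 by omega) hbn
  have hstep : gogamStep b Y = raise i (b + 1) Y :=
    gogamStep_eq_raise (m := b + 1) (by omega) him (hc _ (by omega) (by omega)) fun r h1 h2 =>
      (hi r h1 h2).ne'
  have hmixed := raise_isMixed (m := b + 1) hY ht hti him hbn he hc (fun h => hi i h le_rfl) hinv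
  rw [hstep]
  refine ⟨i, by omega, hmixed, inversions_replace h (fun j hj => ?_) (fun j hj => ?_) (by omega)
    (by omega) fun r _ _ => raise_inversion_iff (m := b + 1) him he
      (fun r h1 h2 => hinv r (by omega) h2) r, ?_⟩
  · have := hp.2.2 j hj b List.mem_cons_self
    omega
  · have := hL j hj
    omega
  · rw [gogStep_eq_lower (m := b + 1) hbn, lower_raise (m := b + 1) he]
    · rw [raise_two, raise_two, if_pos (by omega), if_pos (by omega), hc (i + 1) (by omega) him]
    · intro r h1 h2
      have := hY.gt.second_anti (show 2 ≤ b + 1 by omega) (show b + 1 ≤ r by omega) h2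
      rw [raise_two, raise_two, if_neg (by omega), if_pos (by omega), hc (i + 1) (by omega) him]
      omega

/-- `J` holds the inversions already moved, `L` those still to be treated, and `K` the new positions
of the latter. Since order is preserved, the inverse algorithm meets the entries of `K` in reverse
and undoes the steps one by one. -/
theorem foldl_gogStep (L : List ℕ) : ∀ (J : List ℕ) (t : ℕ) (Y : Entries), IsMixed n t Y → t ≤ n →
    inversions n Y = J ++ L → (∀ j ∈ J, t ≤ j) → (∀ i ∈ L, i < t) →
    ∃ K : List ℕ, K.length = L.length ∧ inversions n (L.foldl (gogStep n) Y) = J ++ K ∧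
      IsMixed n 1 (L.foldl (gogStep n) Y) ∧ L.foldl (gogStep n) Y 1 1 = Y 1 1 ∧
      ∀ l ≤ L.length, IsGTTrapezoid n 2 ((L.take l).foldl (gogStep n) Y) ∧
        (K.drop l).foldr gogamStep (L.foldl (gogStep n) Y) =
          (L.take l).foldl (gogStep n) Y := by
  induction L with
  | nil =>
    intro J t Y hY ht h hJ _
    refine ⟨[], rfl, h, ⟨hY.gt, hY.bot, hY.le, fun i _ _ => by omega, fun i h1 _ h2 h3 => ?_,
      fun _ => by omega⟩, rfl, fun l _ => ⟨by simpa using hY.gt, by simp⟩⟩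
    -- With nothing pending, every inversion is at least `t`, so the condition from `t` on holds
    -- everywhere.
    refine hY.inv i h1 (hJ i ?_) h2 h3
    have : i ∈ inversions n Y := mem_inversions.2 ⟨h1, h2, h3⟩
    simpa [h] using this
  | cons i L ih =>
    intro J t Y hY ht h hJ hL
    have hit := hL i List.mem_cons_self
    obtain ⟨b, hib, hmix, hinv, hback, h11⟩ := exists_gogStep hY ht h hJ hit
    have hp := inversions_pairwise n Y
    rw [h, List.pairwise_append, List.pairwise_cons] at hp
    obtain ⟨K, hK, hZ, hZm, hZ1, hl⟩ := ih (J ++ [b]) i _ hmix (by omega)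
      (by rw [hinv, List.append_assoc]; rfl)
      (fun j hj => by
        rcases List.mem_append.1 hj with hj | hj
        · exact (hit.trans_le (hJ j hj)).le
        · rwa [List.mem_singleton.1 hj])
      hp.2.1.1
    refine ⟨b :: K, by simp [hK], by rw [List.foldl_cons, hZ, List.append_assoc]; rfl, hZm,
      hZ1.trans h11, fun l hle => ?_⟩
    cases l with
    | zero =>
      have h0 := (hl 0 (Nat.zero_le _)).2
      simp only [List.drop_zero, List.take_zero, List.foldl_nil] at h0
      refine ⟨hY.gt, ?_⟩
      simp only [List.drop_zero, List.take_zero, List.foldl_nil, List.foldr_cons, List.foldl_cons,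
        h0, hback]
    | succ l => exact hl l (by simpa using hle)

/-- Here `J` is pending and treated from its last, smallest element `b`, which changes the level
into `b + 1`. -/
theorem foldr_gogamStep (J : List ℕ) : ∀ (L : List ℕ) (t : ℕ) (Y : Entries), IsMixed n t Y →
    1 ≤ t → t ≤ n → inversions n Y = J ++ L → (∀ j ∈ J, t ≤ j) → (∀ i ∈ L, i < t) →
    ∃ K : List ℕ, inversions n (J.foldr gogamStep Y) = K ++ L ∧
      IsMixed n n (J.foldr gogamStep Y) ∧ K.foldl (gogStep n) (J.foldr gogamStep Y) = Y := by
  induction J using List.reverseRecOn with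
  | nil =>
    intro L t Y hY ht htn h _ hL
    refine ⟨[], h, ⟨hY.gt, hY.bot, hY.le, fun i h1 h2 => ?_, fun i _ _ => by omega,
      fun _ => by omega⟩, rfl⟩
    -- With nothing pending, no inversion is at least `t`, so rows beyond `t` are strict as well.
    rcases Nat.lt_or_ge t i with h3 | h3
    · have h4 := hY.gt.le_left (i - 1) 1 le_rfl (by omega) (by omega) (by omega)
      have h5 := hY.gt.le_right (i - 1) 1 le_rfl (by omega) (by omega) le_rfl
      have h6 : Y (i - 1) 1 ≠ Y (i - 1 + 1) 1 := fun h6 => by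
        have : i - 1 ∈ inversions n Y := mem_inversions.2 ⟨by omega, by omega, h6⟩
        rw [h] at this
        have := hL _ this
        omega
      rw [Nat.sub_add_cancel (by omega)] at h4 h5 h6
      change _ ≤ Y i 2 at h5
      change Y i 1 < Y i 2
      omega
    · exact hY.lt i h1 h3
  | append_singleton J b ih =>
    intro L t Y hY ht htn h hJ hL
    have h' : inversions n Y = J ++ b :: L := by rw [h, List.append_assoc]; rfl
    have htb : t ≤ b := hJ b (by simp)
    obtain ⟨i, hib, hmix, hinv, hback⟩ := exists_gogamStep hY ht h' hL htb
    have hp := inversions_pairwise n Y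
    rw [h', List.pairwise_append, List.pairwise_cons] at hp
    have hbn := (mem_inversions.1 (show b ∈ inversions n Y by simp [h'])).2.1
    obtain ⟨K, hK, hKm, hKY⟩ := ih (i :: L) (b + 1) _ hmix (by omega) hbn hinv
      (fun j hj => hp.2.2 j hj b List.mem_cons_self)
      (fun j hj => by
        rcases List.mem_cons.1 hj with rfl | hj
        · omega
        · have := hL j hj
          omega)
    rw [List.foldr_append]
    refine ⟨K ++ [i], by rw [List.append_assoc]; exact hK, hKm, ?_⟩
    rw [List.foldl_append]
    change gogStep n (K.foldl (gogStep n) (J.foldr gogamStep (gogamStep b Y))) i = Y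
    rw [hKY, hback]

theorem gogToGOGAm_spec {X : Entries} (hX : IsMixed n n X) :
    IsMixed n 1 (gogToGOGAm n X) ∧
      (inversions n (gogToGOGAm n X)).length = (inversions n X).length ∧
      gogToGOGAm n X 1 1 = X 1 1 ∧
      ∀ l : ℕ, l ≤ (inversions n X).length →
        IsGTTrapezoid n 2 (gogStage n X l) ∧
        gogamStage n (gogToGOGAm n X) l = gogStage n X l := by
  obtain ⟨K, hK, hZ, hZm, h11, hl⟩ := foldl_gogStep (inversions n X) [] n X hX le_rfl rfl
    (by simp) fun i hi => (mem_inversions.1 hi).2.1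
  have hfold : gogToGOGAm n X = (inversions n X).foldl (gogStep n) X := by
    rw [gogToGOGAm, gogStage, List.take_length]
  rw [← hfold, List.nil_append] at hZ
  rw [← hfold] at hZm h11 hl
  refine ⟨hZm, by rw [hZ, hK], h11, fun l h => ?_⟩
  rw [gogamStage, hZ]
  exact hl l h

theorem gogamToGog_spec (hn : 1 ≤ n) {Y : Entries} (hY : IsMixed n 1 Y) :
    IsMixed n n (gogamToGog n Y) ∧ gogToGOGAm n (gogamToGog n Y) = Y := by
  obtain ⟨K, hK, hKm, hKY⟩ := foldr_gogamStep (inversions n Y) [] 1 Y hY le_rfl hn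
    (List.append_nil _).symm (fun j hj => (mem_inversions.1 hj).1) (by simp)
  rw [List.append_nil] at hK
  refine ⟨hKm, ?_⟩
  rw [gogToGOGAm, gogStage, List.take_length]
  change (inversions n ((inversions n Y).foldr gogamStep Y)).foldl (gogStep n)
    ((inversions n Y).foldr gogamStep Y) = Y
  rw [hK, hKY]

theorem gog_gogam_invOn (hn : 1 ≤ n) :
    Set.InvOn (gogamToGog n) (gogToGOGAm n) (leftGog n 2) (leftGOGAm n 2) := by
  rw [leftGog_two hn, leftGOGAm_two hn]
  refine ⟨fun X hX => ?_, fun Y hY => (gogamToGog_spec hn hY).2⟩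
  have := ((gogToGOGAm_spec hX).2.2.2 0 (Nat.zero_le _)).2
  exact this.trans (by simp [gogStage])

theorem gogToGOGAm_mapsTo (hn : 1 ≤ n) :
    Set.MapsTo (gogToGOGAm n) (leftGog n 2) (leftGOGAm n 2) := by
  rw [leftGog_two hn, leftGOGAm_two hn]
  exact fun X hX => (gogToGOGAm_spec hX).1

theorem gogamToGog_mapsTo (hn : 1 ≤ n) :
    Set.MapsTo (gogamToGog n) (leftGOGAm n 2) (leftGog n 2) := by
  rw [leftGog_two hn, leftGOGAm_two hn]
  exact fun X hX => (gogamToGog_spec hn hX).1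

end Bijection

end GogTrapezoid

theorem mainTheorem2 :
    -- shape `(n, 1)`: the two sets of trapezoids coincide
    (∀ n : ℕ, 1 ≤ n →
      leftGog n 1 = leftGOGAm n 1 ∧
      leftGog n 1 = {X | IsGTTrapezoid n 1 X ∧ ∀ j : ℕ, 1 ≤ j → j ≤ n → X j 1 ≤ (n : ℤ) - j + 1}) ∧
    -- shape `(n, 2)`: the algorithm is a bijection, with the inverse algorithm as its inverse
    (∀ n : ℕ, 2 ≤ n →
      Set.BijOn (gogToGOGAm n) (leftGog n 2) (leftGOGAm n 2) ∧
      Set.BijOn (gogamToGog n) (leftGOGAm n 2) (leftGog n 2) ∧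
      Set.InvOn (gogamToGog n) (gogToGOGAm n) (leftGog n 2) (leftGOGAm n 2) ∧
      ∀ X ∈ leftGog n 2,
        (inversions n (gogToGOGAm n X)).length = (inversions n X).length ∧
        gogToGOGAm n X 1 1 = X 1 1 ∧
        ∀ l : ℕ, l ≤ (inversions n X).length →
          IsGTTrapezoid n 2 (gogStage n X l) ∧
          gogamStage n (gogToGOGAm n X) l = gogStage n X l) ∧
    -- equinumeration of left Gog and GOGAm trapezoids with one or two diagonals
    (∀ n k : ℕ, k = 1 ∨ k = 2 → k ≤ n →
      (leftGog n k).Finite ∧ (leftGOGAm n k).Finite ∧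
      (leftGog n k).ncard = (leftGOGAm n k).ncard) := by
  have hbij : ∀ n : ℕ, 1 ≤ n → Set.BijOn (gogToGOGAm n) (leftGog n 2) (leftGOGAm n 2) :=
    fun n hn => (gog_gogam_invOn hn).bijOn (gogToGOGAm_mapsTo hn) (gogamToGog_mapsTo hn)
  refine ⟨fun n hn => ⟨(leftGog_one hn).trans (leftGOGAm_one hn).symm, leftGog_one hn⟩,
    fun n hn => ?_, ?_⟩
  · have hn' : 1 ≤ n := by omega
    refine ⟨hbij n hn', (gog_gogam_invOn hn').symm.bijOn (gogamToGog_mapsTo hn')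
      (gogToGOGAm_mapsTo hn'), gog_gogam_invOn hn', fun X hX => ?_⟩
    rw [leftGog_two hn'] at hX
    exact (gogToGOGAm_spec hX).2
  · rintro n k (rfl | rfl) hk
    · have hfin : (leftGog n 1).Finite := by
        rw [leftGog, image_leftPart_one]
        change (leftPart 1 '' leftGog n 2).Finite
        rw [leftGog_two hk]
        exact (finite_setOf_isMixed n n).image _
      have heq := (leftGog_one hk).trans (leftGOGAm_one hk).symm
      exact ⟨hfin, heq ▸ hfin, by rw [heq]⟩
    · have hn : 1 ≤ n := by omega
      refine ⟨leftGog_two hn ▸ finite_setOf_isMixed n n, leftGOGAm_two hn ▸ finite_setOf_isMixed n 1,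
        ?_⟩
      rw [← (hbij n hn).image_eq, (hbij n hn).injOn.ncard_image]
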